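/- Let $(\Omega,\mathcal A,\mathbb P)$ be a probability space, let $(\mathcal X,\mathcal S)$ be a measurable space, and let $\mathbf X = X_1, X_2, \ldots$ be a stationary ergodic process on $(\Omega,\mathcal A,\mathbb P)$ with values in $(\mathcal X,\mathcal S)$; that is, the law of $\mathbf X$ on the sequence space $\mathcal X^{\mathbb N}$ (with the product $\sigma$-algebra) is invariant under the left shift, and every measurable shift-invariant set of sequences has probability $0$ or $1$ under it. Let $\mathcal C \subseteq \mathcal S$ be a family of measurable sets such that (a) $\mathcal C$ is a VC class: there is a finite bound on the cardinalities of the finite sets $D \subseteq \mathcal X$ shattered by $\mathcal C$, where $\mathcal C$ shatters $D$ if every subset of $D$ is of the form $C \cap D$ with $C \in \mathcal C$; (b) $\mathcal C$ is separable: there is a countable subfamily $\mathcal C_0 \subseteq \mathcal C$ such that for each $C \in \mathcal C$ the indicator function $I_C$ is the pointwise limit on $\mathcal X$ of a sequence of indicator functions of members of $\mathcal C_0$. Then $$\Delta_n(\mathcal C : \mathbf X) = \sup_{C \in \mathcal C} \left| \frac1n \sum_{i=1}^n I_C(X_i) - \mathbb P(X_1 \in C) \right| \longrightarrow 0 \quad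 \text{almost surely as } n \to \infty .$$ (If $\mathcal C$ is empty, the supremum is taken to be $0$.) -/

import Mathlib

open MeasureTheory Filter Topology

/-- The family `𝒞` shatters the finite set `D`: every subset of `D` is of the form `C ∩ D` with
`C ∈ 𝒞`. -/
def FamilyShatters {S : Type*} (𝒞 : Set (Set S)) (D : Finset S) : Prop :=
  ∀ E : Set S, E ⊆ (D : Set S) → ∃ C ∈ 𝒞, C ∩ (D : Set S) = E

/-- The Vapnik-Chervonenkis dimension of `𝒞`, with values in `ℕ∞`: the supremum of the
cardinalities of the finite sets that `𝒞` shatters. -/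
noncomputable def vcDimension {S : Type*} (𝒞 : Set (Set S)) : ℕ∞ :=
  ⨆ (D : Finset S) (_ : FamilyShatters 𝒞 D), (D.card : ℕ∞)

/-- A VC class is a family of sets of finite Vapnik-Chervonenkis dimension. -/
def IsVCClass {S : Type*} (𝒞 : Set (Set S)) : Prop :=
  vcDimension 𝒞 < ⊤

/-- A family `F` of real functions is separable if it has a countable subfamily `F₀` such that each
member of `F` is the pointwise limit of a sequence in `F₀`. -/
def IsSeparableFamily {S : Type*} (F : Set (S → ℝ)) : Prop :=
  ∃ F₀ : Set (S → ℝ), F₀ ⊆ F ∧ F₀.Countable ∧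
    ∀ f ∈ F, ∃ g : ℕ → S → ℝ, (∀ k, g k ∈ F₀) ∧
      ∀ x, Tendsto (fun k => g k x) atTop (𝓝 (f x))

/-- A family of sets is separable if the family of indicator functions of its members is. -/
def IsSeparableClass {S : Type*} (𝒞 : Set (Set S)) : Prop :=
  IsSeparableFamily ((fun C : Set S => C.indicator (fun _ => (1 : ℝ))) '' 𝒞)

/-- The law of the process `X`, a measure on the space of sequences with the product
sigma-algebra. -/
noncomputable def processLaw {Ω S : Type*} [MeasurableSpace Ω] [MeasurableSpace S]
    (P : Measure Ω) (X : ℕ → Ω → S) : Measure (ℕ → S) :=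
  P.map (fun ω i => X i ω)

/-- The left shift on sequences. -/
def seqShift {S : Type*} (x : ℕ → S) : ℕ → S := fun i => x (i + 1)

/-- The process `X` is stationary: for each `k`, the process `(X (i + k))` has the same law as the
process `(X i)`. -/
def IsStationaryProcess {Ω S : Type*} [MeasurableSpace Ω] [MeasurableSpace S]
    (P : Measure Ω) (X : ℕ → Ω → S) : Prop :=
  ∀ k : ℕ, processLaw P (fun i => X (i + k)) = processLaw P X

/-- The process `X` is ergodic: every measurable shift-invariant set of sequences has probability
zero or one under the law of `X`. -/
def IsErgodicProcess {Ω S : Type*} [MeasurableSpace Ω] [MeasurableSpace S]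
    (P : Measure Ω) (X : ℕ → Ω → S) : Prop :=
  ∀ A : Set (ℕ → S), MeasurableSet A → seqShift ⁻¹' A = A →
    processLaw P X A = 0 ∨ processLaw P X A = 1

/-- The discrepancy `sup_{C ∈ 𝒞} |n⁻¹ ∑_{i < n} I_C(X i ω) - P(X 0 ∈ C)|`. The quantities in the
supremum lie in `[0, 1]`; the supremum over the empty family is `0`. -/
noncomputable def discrepancy {Ω S : Type*} [MeasurableSpace Ω]
    (P : Measure Ω) (X : ℕ → Ω → S) (𝒞 : Set (Set S)) (n : ℕ) (ω : Ω) : ℝ :=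
  ⨆ C : 𝒞, |(n : ℝ)⁻¹ * ∑ i ∈ Finset.range n, (C : Set S).indicator (fun _ => (1 : ℝ)) (X i ω)
    - P.real {ω' | X 0 ω' ∈ (C : Set S)}|

section Ergodic

variable {α : Type*} {T : α → α} {g : α → ℝ}

/-- The maximum of `0` and the first `n` Birkhoff sums, defined recursively. -/
noncomputable def birkhoffMaximum (T : α → α) (g : α → ℝ) : ℕ → α → ℝ
  | 0 => fun _ => 0
  | n + 1 => fun x => max 0 (g x + birkhoffMaximum T g n (T x))

lemma birkhoffMaximum_succ (n : ℕ) (x : α) :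
    birkhoffMaximum T g (n + 1) x = max 0 (g x + birkhoffMaximum T g n (T x)) := rfl

lemma birkhoffMaximum_nonneg (n : ℕ) (x : α) : 0 ≤ birkhoffMaximum T g n x := by
  cases n with
  | zero => exact le_rfl
  | succ n => exact le_max_left _ _

lemma birkhoffMaximum_le_succ (n : ℕ) (x : α) :
    birkhoffMaximum T g n x ≤ birkhoffMaximum T g (n + 1) x := by
  induction n generalizing x with
  | zero => exact birkhoffMaximum_nonneg _ _
  | succ n ih =>
    rw [birkhoffMaximum_succ, birkhoffMaximum_succ (n + 1)]
    gcongr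
    exact ih _

lemma birkhoffMaximum_mono (x : α) : Monotone fun n => birkhoffMaximum T g n x :=
  monotone_nat_of_le_succ fun n => birkhoffMaximum_le_succ n x

lemma birkhoffSum_le_birkhoffMaximum (n : ℕ) (x : α) :
    birkhoffSum T g n x ≤ birkhoffMaximum T g n x := by
  induction n generalizing x with
  | zero => simp [birkhoffMaximum]
  | succ n ih =>
    rw [birkhoffSum_succ', birkhoffMaximum_succ]
    exact le_max_of_le_right (by gcongr; exact ih _)

variable [MeasurableSpace α] {μ : Measure α}

lemma measurable_birkhoffMaximum (hT : Measurable T) (hg : Measurable g) (n : ℕ) :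
    Measurable (birkhoffMaximum T g n) := by
  induction n with
  | zero => exact measurable_const
  | succ n ih => exact measurable_const.max (hg.add (ih.comp hT))

lemma integrable_birkhoffMaximum (hT : MeasurePreserving T μ μ) (hg : Integrable g μ) (n : ℕ) :
    Integrable (birkhoffMaximum T g n) μ := by
  induction n with
  | zero => exact integrable_zero _ _ _
  | succ n ih =>
    exact (integrable_zero α ℝ μ).sup (hg.add (hT.integrable_comp_of_integrable ih))

/-- The maximal ergodic inequality. -/
theorem setIntegral_birkhoffMaximum_pos_nonneg (hT : MeasurePreserving T μ μ)
    (hgm : Measurable g) (hg : Integrable g μ) (n : ℕ) :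
    0 ≤ ∫ x in {x | 0 < birkhoffMaximum T g (n + 1) x}, g x ∂μ := by
  have hm : MeasurableSet {x | 0 < birkhoffMaximum T g (n + 1) x} :=
    measurableSet_lt measurable_const (measurable_birkhoffMaximum hT.measurable hgm _)
  have hi := integrable_birkhoffMaximum hT hg n
  have hi' := integrable_birkhoffMaximum hT hg (n + 1)
  have hc : ∫ x, birkhoffMaximum T g n (T x) ∂μ = ∫ x, birkhoffMaximum T g n x ∂μ := by
    rw [← integral_map hT.measurable.aemeasurable (by rw [hT.map_eq]; exact hi.1), hT.map_eq]
  rw [← integral_indicator hm]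
  calc (0 : ℝ) ≤ ∫ x, birkhoffMaximum T g (n + 1) x ∂μ - ∫ x, birkhoffMaximum T g n (T x) ∂μ := by
        rw [hc, sub_nonneg]
        exact integral_mono hi hi' fun x => birkhoffMaximum_le_succ n x
    _ = ∫ x, (birkhoffMaximum T g (n + 1) x - birkhoffMaximum T g n (T x)) ∂μ :=
        (integral_sub hi' (hT.integrable_comp_of_integrable hi)).symm
    _ ≤ _ := by
        refine integral_mono (hi'.sub (hT.integrable_comp_of_integrable hi))
          (hg.indicator hm) fun x => ?_
        by_cases hx : 0 < birkhoffMaximum T g (n + 1) x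
        · rw [Set.indicator_of_mem (by exact hx)]
          have h := birkhoffMaximum_succ (T := T) (g := g) n x
          rcases max_choice 0 (g x + birkhoffMaximum T g n (T x)) with h' | h' <;>
            simp only [h'] at h <;> linarith
        · rw [Set.indicator_of_notMem (by exact hx)]
          have := birkhoffMaximum_nonneg (T := T) (g := g) n (T x)
          linarith

theorem integral_nonneg_of_ae_exists_birkhoffSum_pos (hT : MeasurePreserving T μ μ)
    (hgm : Measurable g) (hg : Integrable g μ) (h : ∀ᵐ x ∂μ, ∃ n, 0 < birkhoffSum T g n x) :
    0 ≤ ∫ x, g x ∂μ := by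
  have hm (n : ℕ) : MeasurableSet {x | 0 < birkhoffMaximum T g (n + 1) x} :=
    measurableSet_lt measurable_const (measurable_birkhoffMaximum hT.measurable hgm _)
  have hlim : Tendsto (fun n : ℕ => ∫ x, {x | 0 < birkhoffMaximum T g (n + 1) x}.indicator g x ∂μ)
      atTop (𝓝 (∫ x, g x ∂μ)) := by
    refine tendsto_integral_of_dominated_convergence (fun x => ‖g x‖)
      (fun n => (hg.indicator (hm n)).1) hg.norm
      (fun n => ae_of_all _ fun x => norm_indicator_le_norm_self _ _) ?_
    filter_upwards [h] with x ⟨m, hx⟩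
    refine tendsto_const_nhds.congr' ?_
    filter_upwards [eventually_ge_atTop m] with n hn
    rw [Set.indicator_of_mem]
    exact hx.trans_le ((birkhoffSum_le_birkhoffMaximum m x).trans
      (birkhoffMaximum_mono x (hn.trans n.le_succ)))
  refine ge_of_tendsto' hlim fun n => ?_
  rw [integral_indicator (hm n)]
  exact setIntegral_birkhoffMaximum_pos_nonneg hT hgm hg n

lemma measurable_birkhoffSum (hT : Measurable T) (hg : Measurable g) (n : ℕ) :
    Measurable (birkhoffSum T g n) :=
  Finset.measurable_fun_sum _ fun k _ => hg.comp (hT.iterate k)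

theorem Ergodic.ae_bddAbove_birkhoffSum (hT : Ergodic T μ) (hgm : Measurable g)
    (hg : Integrable g μ) (hneg : ∫ x, g x ∂μ < 0) :
    ∀ᵐ x ∂μ, ∃ K : ℝ, ∀ n, birkhoffSum T g n x ≤ K := by
  set E : Set α := {x | ∀ K : ℕ, ∃ n, (K : ℝ) < birkhoffSum T g n x} with hE
  have hEm : MeasurableSet E := by
    have : E = ⋂ K : ℕ, ⋃ n, {x | (K : ℝ) < birkhoffSum T g n x} := by ext; simp [hE]
    rw [this]
    exact .iInter fun K => .iUnion fun n =>
      measurableSet_lt measurable_const (measurable_birkhoffSum hT.measurable hgm n)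
  have hinv : T ⁻¹' E = E := by
    ext x
    constructor
    · intro hx K
      obtain ⟨K', hK'⟩ := exists_nat_ge ((K : ℝ) - g x)
      obtain ⟨n, hn⟩ := hx K'
      exact ⟨n + 1, by rw [birkhoffSum_succ']; linarith⟩
    · intro hx K
      obtain ⟨K', hK'⟩ := exists_nat_ge ((K : ℝ) + |g x|)
      obtain ⟨n, hn⟩ := hx K'
      cases n with
      | zero =>
        rw [birkhoffSum_zero] at hn
        exact absurd hn (not_lt.2 (Nat.cast_nonneg _))
      | succ n =>
        rw [birkhoffSum_succ'] at hn
        exact ⟨n, by linarith [le_abs_self (g x)]⟩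
  rcases hT.ae_mem_or_ae_notMem hEm hinv with h | h
  · refine absurd (integral_nonneg_of_ae_exists_birkhoffSum_pos hT.toMeasurePreserving hgm hg ?_)
      (not_le.2 hneg)
    filter_upwards [h] with x hx
    simpa using hx 0
  · filter_upwards [h] with x hx
    simp only [hE, Set.mem_ofPred_eq, not_forall, not_exists, not_lt] at hx
    obtain ⟨K, hK⟩ := hx
    exact ⟨K, hK⟩

theorem Ergodic.ae_eventually_birkhoffAverage_le [IsProbabilityMeasure μ] (hT : Ergodic T μ)
    (hgm : Measurable g) (hg : Integrable g μ) {c : ℝ} (hc : ∫ x, g x ∂μ < c) :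
    ∀ᵐ x ∂μ, ∀ᶠ n in atTop, birkhoffAverage ℝ T g n x < c := by
  obtain ⟨d, hd, hdc⟩ := exists_between hc
  have hneg : ∫ x, (g x - d) ∂μ < 0 := by
    rw [integral_sub hg (integrable_const _)]
    simpa using hd
  filter_upwards [hT.ae_bddAbove_birkhoffSum (hgm.sub_const d) (hg.sub (integrable_const d)) hneg]
    with x ⟨K, hK⟩
  have hlim : Tendsto (fun n : ℕ => d + K / n) atTop (𝓝 (d + 0)) :=
    tendsto_const_nhds.add (tendsto_const_nhds.div_atTop tendsto_natCast_atTop_atTop)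
  rw [add_zero] at hlim
  filter_upwards [hlim.eventually_lt_const hdc, eventually_gt_atTop 0] with n hn hn0
  refine lt_of_le_of_lt ?_ hn
  have hn0' : (0 : ℝ) < n := by exact_mod_cast hn0
  have h := hK n
  simp only [birkhoffSum, Finset.sum_sub_distrib, Finset.sum_const, Finset.card_range,
    nsmul_eq_mul] at h
  rw [birkhoffAverage, birkhoffSum, smul_eq_mul, inv_mul_le_iff₀ hn0']
  field_simp
  linarith

/-- Birkhoff's pointwise ergodic theorem for ergodic transformations. -/
theorem Ergodic.ae_tendsto_birkhoffAverage [IsProbabilityMeasure μ] (hT : Ergodic T μ)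
    (hgm : Measurable g) (hg : Integrable g μ) :
    ∀ᵐ x ∂μ, Tendsto (fun n => birkhoffAverage ℝ T g n x) atTop (𝓝 (∫ x, g x ∂μ)) := by
  have hupper {g : α → ℝ} (hgm : Measurable g) (hg : Integrable g μ) :
      ∀ᵐ x ∂μ, ∀ m : ℕ, ∀ᶠ n in atTop,
        birkhoffAverage ℝ T g n x < ∫ x, g x ∂μ + 1 / ((m : ℝ) + 1) :=
    ae_all_iff.2 fun m => hT.ae_eventually_birkhoffAverage_le hgm hg
      (lt_add_of_pos_right _ Nat.one_div_pos_of_nat)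
  filter_upwards [hupper hgm hg, hupper hgm.neg hg.neg] with x h₁ h₂
  refine Metric.tendsto_nhds.2 fun ε hε => ?_
  obtain ⟨m, hm⟩ := exists_nat_one_div_lt hε
  filter_upwards [h₁ m, h₂ m] with n hn₁ hn₂
  simp only [birkhoffAverage_neg, Pi.neg_apply, integral_neg] at hn₂
  rw [Real.dist_eq, abs_lt]
  constructor <;> linarith

end Ergodic

section Bracketing

variable {S ι : Type*}

/-- The points on which the members of the subfamily `G` of `f` disagree. -/
def familyGap (f : ι → Set S) (G : Set ι) : Set S := (⋃ i ∈ G, f i) \ ⋂ i ∈ G, f i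

lemma mem_familyGap {f : ι → Set S} {G : Set ι} {x : S} :
    x ∈ familyGap f G ↔ (∃ i ∈ G, x ∈ f i) ∧ ∃ i ∈ G, x ∉ f i := by
  simp [familyGap]

lemma familyGap_mono {f : ι → Set S} {G H : Set ι} (h : G ⊆ H) :
    familyGap f G ⊆ familyGap f H := by
  intro x hx
  obtain ⟨⟨i, hi, hxi⟩, j, hj, hxj⟩ := mem_familyGap.1 hx
  exact mem_familyGap.2 ⟨⟨i, h hi, hxi⟩, j, h hj, hxj⟩

lemma measurableSet_familyGap [MeasurableSpace S] [Countable ι] {f : ι → Set S}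
    (hf : ∀ i, MeasurableSet (f i)) (G : Set ι) : MeasurableSet (familyGap f G) :=
  (MeasurableSet.biUnion G.to_countable fun i _ => hf i).diff
    (MeasurableSet.biInter G.to_countable fun i _ => hf i)

/-- A family is finitely covered by subfamilies with small gap, or some ultrafilter on its indices
contains no set with small gap. -/
lemma exists_ultrafilter_le_measure_familyGap [MeasurableSpace S] {μ : Measure S} {f : ι → Set S}
    {ε : ENNReal} (h : ¬ ∃ 𝒢 : Set (Set ι), 𝒢.Finite ∧ ⋃₀ 𝒢 = Set.univ ∧
      ∀ G ∈ 𝒢, μ (familyGap f G) < ε) :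
    ∃ 𝔲 : Ultrafilter ι, ∀ G ∈ 𝔲, ε ≤ μ (familyGap f G) := by
  let p : Set ι → Prop := fun t => ∃ 𝒢 : Set (Set ι), 𝒢.Finite ∧ t ⊆ ⋃₀ 𝒢 ∧
    ∀ G ∈ 𝒢, μ (familyGap f G) < ε
  let l : Filter ι := Filter.comk p ⟨∅, Set.finite_empty, by simp, by simp⟩
    (fun t ⟨𝒢, h1, h2, h3⟩ s hs => ⟨𝒢, h1, hs.trans h2, h3⟩)
    (fun s ⟨𝒢, h1, h2, h3⟩ t ⟨ℋ, h1', h2', h3'⟩ =>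
      ⟨𝒢 ∪ ℋ, h1.union h1', by
        rw [Set.sUnion_union]; exact Set.union_subset_union h2 h2', by
        rintro G (hG | hG)
        exacts [h3 G hG, h3' G hG]⟩)
  have hl : l.NeBot := by
    rw [Filter.neBot_iff]
    intro hbot
    have : (∅ : Set ι) ∈ l := by rw [hbot]; exact Filter.mem_bot
    obtain ⟨𝒢, h1, h2, h3⟩ : p ∅ᶜ := this
    exact h ⟨𝒢, h1, Set.eq_univ_of_univ_subset (by simpa using h2), h3⟩
  obtain ⟨𝔲, h𝔲⟩ := Ultrafilter.exists_le l
  refine ⟨𝔲, fun G hG => ?_⟩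
  by_contra! hlt
  have : Gᶜ ∈ l := show p Gᶜᶜ from ⟨{G}, Set.finite_singleton _, by simp, by simpa using hlt⟩
  exact Ultrafilter.compl_notMem_iff.2 hG (h𝔲 this)

/-- The essential intersection of the gaps of the members of a filter. -/
lemma exists_ae_subset_familyGap [MeasurableSpace S] [Countable ι] {μ : Measure S}
    [IsFiniteMeasure μ] {f : ι → Set S} (hf : ∀ i, MeasurableSet (f i)) {l : Filter ι}
    {ε : ENNReal} (h : ∀ G ∈ l, ε ≤ μ (familyGap f G)) :
    ∃ B : Set S, ε ≤ μ B ∧ ∀ G ∈ l, μ (B \ familyGap f G) = 0 := by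
  set V : Set ENNReal := (fun G => μ (familyGap f G)) '' {G | G ∈ l} with hV
  have hne : V.Nonempty := ⟨_, Set.univ, Filter.univ_mem, rfl⟩
  obtain ⟨u, -, hu, huV⟩ := exists_seq_tendsto_sInf hne (OrderBot.bddBelow V)
  choose G hG hGu using huV
  let H : ℕ → Set ι := fun k => ⋂ j ∈ Finset.range (k + 1), G j
  have hHl (k : ℕ) : H k ∈ l := (Filter.biInter_finset_mem _).2 fun j _ => hG j
  have hHanti : Antitone H := fun a b hab =>
    Set.biInter_subset_biInter_left fun j hj => by
      simp only [Finset.coe_range, Set.mem_Iio] at hj ⊢; omega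
  have hanti : Antitone fun k => familyGap f (H k) := fun a b hab => familyGap_mono (hHanti hab)
  have hle (k : ℕ) : μ (familyGap f (H k)) ≤ u k := by
    rw [← hGu k]
    exact measure_mono (familyGap_mono (Set.biInter_subset_of_mem (by simp)))
  have hinf (K : Set ι) (hK : K ∈ l) : sInf V ≤ μ (familyGap f K) := sInf_le ⟨K, hK, rfl⟩
  have hBle : μ (⋂ k, familyGap f (H k)) ≤ sInf V :=
    ge_of_tendsto' hu fun k => (measure_mono (Set.iInter_subset _ k)).trans (hle k)
  have hinter (K : Set ι) (hK : K ∈ l) :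
      sInf V ≤ μ ((⋂ k, familyGap f (H k)) ∩ familyGap f K) := by
    have hlim := tendsto_measure_iInter_atTop (μ := μ)
      (s := fun k => familyGap f (H k) ∩ familyGap f K)
      (fun k => ((measurableSet_familyGap hf _).inter
        (measurableSet_familyGap hf _)).nullMeasurableSet)
      (fun a b hab => Set.inter_subset_inter_left _ (hanti hab)) ⟨0, measure_ne_top _ _⟩
    rw [← Set.iInter_inter] at hlim
    refine ge_of_tendsto' hlim fun k => (hinf _ (Filter.inter_mem (hHl k) hK)).trans ?_
    exact measure_mono (Set.subset_inter (familyGap_mono Set.inter_subset_left)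
      (familyGap_mono Set.inter_subset_right))
  refine ⟨⋂ k, familyGap f (H k), ?_, fun K hK => ?_⟩
  · refine le_trans (le_sInf ?_) ((hinter Set.univ Filter.univ_mem).trans
      (measure_mono Set.inter_subset_left))
    rintro _ ⟨K, hK, rfl⟩
    exact h K hK
  · have hadd := measure_inter_add_sdiff (μ := μ) (⋂ k, familyGap f (H k))
      (measurableSet_familyGap hf K)
    have h1 : μ ((⋂ k, familyGap f (H k)) ∩ familyGap f K) + μ ((⋂ k, familyGap f (H k)) \
        familyGap f K) ≤ μ ((⋂ k, familyGap f (H k)) ∩ familyGap f K) + 0 := by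
      rw [hadd, add_zero]
      exact hBle.trans (hinter K hK)
    exact le_antisymm ((ENNReal.add_le_add_iff_left (measure_ne_top _ _)).1 h1) bot_le

/-- A set of positive measure in the core of an ultrafilter is split by almost all sets. -/
lemma eventually_measure_inter_pos_and_diff_pos [MeasurableSpace S] [Countable ι] {μ : Measure S}
    {f : ι → Set S} {𝔲 : Ultrafilter ι} {A : Set S}
    (hA : ∀ G ∈ 𝔲, μ (A \ familyGap f G) = 0) (hpos : 0 < μ A) :
    ∀ᶠ i in (𝔲 : Filter ι), 0 < μ (A ∩ f i) ∧ 0 < μ (A \ f i) := by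
  have key (q : S → ι → Prop) (hq : ∀ G, ∀ x ∈ familyGap f G, ∃ i ∈ G, q x i) :
      ∀ᶠ i in (𝔲 : Filter ι), 0 < μ {x ∈ A | q x i} := by
    by_contra hcon
    rw [← Ultrafilter.eventually_not] at hcon
    have hG := hA _ hcon
    refine hpos.ne' (measure_mono_null (t := (A \ familyGap f {i | ¬ 0 < μ {x ∈ A | q x i}}) ∪
      ⋃ i ∈ {i | ¬ 0 < μ {x ∈ A | q x i}}, {x ∈ A | q x i}) ?_ (measure_union_null hG
        ((measure_biUnion_null_iff (Set.to_countable _)).2 fun i hi => by simpa using hi)))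
    intro x hx
    by_cases hxG : x ∈ familyGap f {i | ¬ 0 < μ {x ∈ A | q x i}}
    · obtain ⟨i, hi, hxi⟩ := hq _ x hxG
      exact Or.inr (Set.mem_biUnion hi ⟨hx, hxi⟩)
    · exact Or.inl ⟨hx, hxG⟩
  exact (key (fun x i => x ∈ f i) fun G x hx => (mem_familyGap.1 hx).1).and
    (key (fun x i => x ∉ f i) fun G x hx => (mem_familyGap.1 hx).2)

lemma exists_independent_of_ultrafilter [MeasurableSpace S] [Countable ι] {μ : Measure S}
    {f : ι → Set S} {𝔲 : Ultrafilter ι} {B : Set S}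
    (hB : ∀ G ∈ 𝔲, μ (B \ familyGap f G) = 0) (hpos : 0 < μ B) (n : ℕ) :
    ∃ i : Fin n → ι, ∀ b : Fin n → Prop, 0 < μ {x ∈ B | ∀ k, x ∈ f (i k) ↔ b k} := by
  induction n with
  | zero => exact ⟨Fin.elim0, fun b => by simpa using hpos⟩
  | succ n ih =>
    obtain ⟨i, hi⟩ := ih
    have hev : ∀ᶠ j in (𝔲 : Filter ι), ∀ b : Fin n → Prop,
        0 < μ ({x ∈ B | ∀ k, x ∈ f (i k) ↔ b k} ∩ f j) ∧
          0 < μ ({x ∈ B | ∀ k, x ∈ f (i k) ↔ b k} \ f j) :=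
      Filter.eventually_all.2 fun b => eventually_measure_inter_pos_and_diff_pos
        (fun G hG => measure_mono_null (Set.sdiff_subset_sdiff_left (Set.sep_subset _ _)) (hB G hG))
        (hi b)
    obtain ⟨j, hj⟩ := hev.exists
    refine ⟨Fin.cons j i, fun b => ?_⟩
    by_cases hb : b 0
    · refine (hj (fun k => b k.succ)).1.trans_le (measure_mono ?_)
      rintro x ⟨⟨hxB, hx⟩, hxj⟩
      refine ⟨hxB, Fin.cases ?_ ?_⟩
      · simpa [hb] using hxj
      · simpa using hx
    · refine (hj (fun k => b k.succ)).2.trans_le (measure_mono ?_)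
      rintro x ⟨⟨hxB, hx⟩, hxj⟩
      refine ⟨hxB, Fin.cases ?_ ?_⟩
      · simpa [hb] using hxj
      · simpa using hx

/-- Boolean independent families of size `2 ^ L` shatter a set of size `L`. -/
lemma exists_familyShatters_of_independent {𝒞 : Set (Set S)} {L : ℕ}
    {C : Set (Fin L) → Set S} (hC : ∀ E, C E ∈ 𝒞)
    (h : ∀ b : Set (Fin L) → Prop, ∃ x, ∀ E, x ∈ C E ↔ b E) :
    ∃ D : Finset S, FamilyShatters 𝒞 D ∧ D.card = L := by
  classical
  choose x hx using fun d : Fin L => h fun E => d ∈ E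
  have hinj : Function.Injective x := fun d e hde => by
    have h := hx d {e}
    rw [hde, hx e {e}] at h
    simpa using h
  refine ⟨Finset.univ.image x, fun E hE => ⟨C {d | x d ∈ E}, hC _, ?_⟩, ?_⟩
  · ext y
    constructor
    · rintro ⟨hy, hyD⟩
      obtain ⟨d, rfl⟩ : ∃ d, x d = y := by simpa using hyD
      exact (hx d _).1 hy
    · intro hy
      obtain ⟨d, rfl⟩ : ∃ d, x d = y := by simpa using hE hy
      exact ⟨(hx d _).2 hy, by simp⟩
  · rw [Finset.card_image_of_injective _ hinj, Finset.card_univ, Fintype.card_fin]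

lemma IsVCClass.not_forall_exists_familyShatters {𝒞 : Set (Set S)} (h : IsVCClass 𝒞) :
    ¬ ∀ L : ℕ, ∃ D : Finset S, FamilyShatters 𝒞 D ∧ D.card = L := by
  intro hsh
  obtain ⟨n, hn⟩ := ENat.ne_top_iff_exists.1 (ne_of_lt h)
  obtain ⟨D, hD, hcard⟩ := hsh (n + 1)
  have hle : (D.card : ℕ∞) ≤ vcDimension 𝒞 :=
    le_iSup₂ (f := fun (D : Finset S) (_ : FamilyShatters 𝒞 D) => (D.card : ℕ∞)) D hD
  rw [← hn, hcard, Nat.cast_le] at hle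
  omega

/-- A countable family of finite Vapnik-Chervonenkis dimension has finite bracketing numbers. -/
theorem IsVCClass.exists_finite_cover_familyGap_lt [MeasurableSpace S] [Countable ι]
    (μ : Measure S) [IsFiniteMeasure μ] {𝒞 : Set (Set S)} (h𝒞 : IsVCClass 𝒞) {f : ι → Set S}
    (hf𝒞 : ∀ i, f i ∈ 𝒞) (hf : ∀ i, MeasurableSet (f i)) {ε : ENNReal} (hε : 0 < ε) :
    ∃ 𝒢 : Set (Set ι), 𝒢.Finite ∧ ⋃₀ 𝒢 = Set.univ ∧ ∀ G ∈ 𝒢, μ (familyGap f G) < ε := by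
  by_contra hcon
  obtain ⟨𝔲, h𝔲⟩ := exists_ultrafilter_le_measure_familyGap hcon
  obtain ⟨B, hεB, hB⟩ := exists_ae_subset_familyGap hf (l := (𝔲 : Filter ι)) h𝔲
  refine h𝒞.not_forall_exists_familyShatters fun L => ?_
  obtain ⟨n, ⟨e⟩⟩ := Finite.exists_equiv_fin (Set (Fin L))
  obtain ⟨i, hi⟩ := exists_independent_of_ultrafilter hB (hε.trans_le hεB) n
  refine exists_familyShatters_of_independent (C := fun E => f (i (e E))) (fun E => hf𝒞 _)
    fun b => ?_
  obtain ⟨x, -, hx⟩ := nonempty_of_measure_ne_zero (hi (b ∘ e.symm)).ne'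
  exact ⟨x, fun E => by simpa using hx (e E)⟩

lemma IsSeparableClass.exists_countable {𝒞 : Set (Set S)} (h : IsSeparableClass 𝒞) :
    ∃ 𝒞₀ ⊆ 𝒞, 𝒞₀.Countable ∧ ∀ C ∈ 𝒞, ∃ c : ℕ → Set S, (∀ k, c k ∈ 𝒞₀) ∧
      ∀ x, ∀ᶠ k in atTop, (x ∈ c k ↔ x ∈ C) := by
  obtain ⟨F₀, hF₀, hcount, hlim⟩ := h
  have hinj : Function.Injective fun C : Set S => C.indicator fun _ => (1 : ℝ) :=
    fun _ _ h => Set.indicator_one_inj ℝ h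
  refine ⟨(fun C : Set S => C.indicator fun _ => (1 : ℝ)) ⁻¹' F₀, fun C hC => ?_,
    hcount.preimage hinj, fun C hC => ?_⟩
  · obtain ⟨D, hD, hDC⟩ := hF₀ hC
    exact hinj hDC ▸ hD
  · obtain ⟨g, hg, hgx⟩ := hlim _ ⟨C, hC, rfl⟩
    choose c hc hcg using fun k => hF₀ (hg k)
    refine ⟨c, fun k => show _ ∈ F₀ from hcg k ▸ hg k, fun x => ?_⟩
    have h := hgx x
    simp only [← hcg] at h
    exact (tendsto_indicator_const_apply_iff_eventually (A := C) atTop (1 : ℝ) x).1 h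

/-- A separable class of measurable sets of finite Vapnik-Chervonenkis dimension has finite
bracketing numbers with respect to every finite measure. -/
theorem IsVCClass.exists_finite_brackets [MeasurableSpace S] (μ : Measure S) [IsFiniteMeasure μ]
    {𝒞 : Set (Set S)} (h𝒞 : IsVCClass 𝒞) (hsep : IsSeparableClass 𝒞)
    (hmeas : ∀ C ∈ 𝒞, MeasurableSet C) {ε : ℝ} (hε : 0 < ε) :
    ∃ 𝓑 : Set (Set S × Set S), 𝓑.Finite ∧
      (∀ p ∈ 𝓑, MeasurableSet p.1 ∧ MeasurableSet p.2 ∧ μ.real (p.2 \ p.1) < ε) ∧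
      ∀ C ∈ 𝒞, ∃ p ∈ 𝓑, p.1 ⊆ C ∧ C ⊆ p.2 := by
  obtain ⟨𝒞₀, hsub, hcount, hlim⟩ := hsep.exists_countable
  have : Countable 𝒞₀ := hcount.to_subtype
  obtain ⟨𝒢, hfin, hcover, hgap⟩ := h𝒞.exists_finite_cover_familyGap_lt μ
    (f := fun C : 𝒞₀ => (C : Set S)) (fun C => hsub C.2) (fun C => hmeas _ (hsub C.2))
    (ENNReal.ofReal_pos.2 hε)
  refine ⟨(fun G : Set 𝒞₀ => ((⋂ C : 𝒞₀, ⋂ (_ : C ∈ G), (C : Set S)),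
    ⋃ C : 𝒞₀, ⋃ (_ : C ∈ G), (C : Set S))) '' 𝒢, hfin.image _, ?_, ?_⟩
  · rintro _ ⟨G, hG, rfl⟩
    refine ⟨.biInter G.to_countable fun C _ => hmeas _ (hsub C.2),
      .biUnion G.to_countable fun C _ => hmeas _ (hsub C.2), ?_⟩
    exact (ENNReal.lt_ofReal_iff_toReal_lt (measure_ne_top _ _)).1 (hgap G hG)
  · intro C hC
    obtain ⟨c, hc, hcC⟩ := hlim C hC
    obtain ⟨G, hG, hfreq⟩ : ∃ G ∈ 𝒢, ∃ᶠ k in atTop, (⟨c k, hc k⟩ : 𝒞₀) ∈ G := by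
      by_contra! hcon
      obtain ⟨k, hk⟩ := ((Filter.eventually_all_finite hfin).2 hcon).exists
      obtain ⟨G, hG, hkG⟩ : (⟨c k, hc k⟩ : 𝒞₀) ∈ ⋃₀ 𝒢 := hcover ▸ Set.mem_univ _
      exact hk G hG hkG
    refine ⟨_, ⟨G, hG, rfl⟩, fun x hx => ?_, fun x hx => ?_⟩
    · obtain ⟨k, hk, hkx⟩ := (hfreq.and_eventually (hcC x)).exists
      exact hkx.1 (Set.mem_iInter₂.1 hx _ hk)
    · obtain ⟨k, hk, hkx⟩ := (hfreq.and_eventually (hcC x)).exists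
      exact Set.mem_biUnion hk (hkx.2 hx)

end Bracketing

section UniformLaw

variable {Ω S : Type*}

lemma seqShift_iterate (x : ℕ → S) (k : ℕ) : seqShift^[k] x = fun i => x (i + k) := by
  induction k with
  | zero => rfl
  | succ k ih =>
    rw [Function.iterate_succ_apply', ih]
    funext i
    simp only [seqShift]
    congr 1
    omega

variable [MeasurableSpace Ω] [MeasurableSpace S]

lemma measurable_seqShift : Measurable (seqShift : (ℕ → S) → ℕ → S) :=
  measurable_pi_lambda _ fun i => measurable_pi_apply (i + 1)

lemma ergodic_seqShift_processLaw {P : Measure Ω} [IsProbabilityMeasure P] {X : ℕ → Ω → S}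
    (hX : ∀ i, Measurable (X i)) (hstat : IsStationaryProcess P X)
    (herg : IsErgodicProcess P X) : Ergodic seqShift (processLaw P X) := by
  have hXm : Measurable fun ω i => X i ω := measurable_pi_lambda _ hX
  have : IsProbabilityMeasure (processLaw P X) :=
    Measure.isProbabilityMeasure_map hXm.aemeasurable
  refine { measurable := measurable_seqShift, map_eq := ?_, aeconst_set := fun A hA hinv => ?_ }
  · rw [processLaw, Measure.map_map measurable_seqShift hXm]
    exact hstat 1
  · rw [Filter.eventuallyConst_set]
    rcases herg A hA hinv with h | h
    · exact Or.inr (measure_eq_zero_iff_ae_notMem.1 h)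
    · exact Or.inl ((mem_ae_iff_prob_eq_one hA).2 h)

theorem ae_tendsto_frequency {P : Measure Ω} [IsProbabilityMeasure P] {X : ℕ → Ω → S}
    (hX : ∀ i, Measurable (X i)) (hstat : IsStationaryProcess P X)
    (herg : IsErgodicProcess P X) {A : Set S} (hA : MeasurableSet A) :
    ∀ᵐ ω ∂P, Tendsto (fun n : ℕ => (n : ℝ)⁻¹ * ∑ i ∈ Finset.range n,
      A.indicator (fun _ => (1 : ℝ)) (X i ω)) atTop (𝓝 ((P.map (X 0)).real A)) := by
  have hXm : Measurable fun ω i => X i ω := measurable_pi_lambda _ hX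
  have : IsProbabilityMeasure (processLaw P X) :=
    Measure.isProbabilityMeasure_map hXm.aemeasurable
  have hgm : Measurable fun x : ℕ → S => A.indicator (fun _ => (1 : ℝ)) (x 0) :=
    (measurable_const.indicator hA).comp (measurable_pi_apply 0)
  have hg : Integrable (fun x : ℕ → S => A.indicator (fun _ => (1 : ℝ)) (x 0))
      (processLaw P X) :=
    .of_bound hgm.aestronglyMeasurable 1 (ae_of_all _ fun x => by
      simpa using norm_indicator_le_norm_self (s := A) (fun _ => (1 : ℝ)) (x 0))
  have hint : ∫ x, A.indicator (fun _ => (1 : ℝ)) (x 0) ∂(processLaw P X) =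
      (P.map (X 0)).real A := by
    rw [processLaw, integral_map hXm.aemeasurable hgm.aestronglyMeasurable,
      ← integral_map (hX 0).aemeasurable (f := A.indicator fun _ => (1 : ℝ))
        (measurable_const.indicator hA).aestronglyMeasurable,
      integral_indicator_const _ hA, smul_eq_mul, mul_one]
  have h := ae_of_ae_map hXm.aemeasurable
    ((ergodic_seqShift_processLaw hX hstat herg).ae_tendsto_birkhoffAverage hgm hg)
  filter_upwards [h] with ω hω
  rw [hint] at hω
  simpa [birkhoffAverage, birkhoffSum, seqShift_iterate] using hω

end UniformLaw

theorem theorem3 {Ω S : Type*} [MeasurableSpace Ω] [MeasurableSpace S]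
    (P : Measure Ω) [IsProbabilityMeasure P]
    (X : ℕ → Ω → S) (hX : ∀ i, Measurable (X i))
    (hstat : IsStationaryProcess P X) (herg : IsErgodicProcess P X)
    (𝒞 : Set (Set S)) (hmeas : ∀ C ∈ 𝒞, MeasurableSet C)
    (hsep : IsSeparableClass 𝒞) (hvc : IsVCClass 𝒞) :
    ∀ᵐ ω ∂P, Tendsto (fun n : ℕ => discrepancy P X 𝒞 n ω) atTop (𝓝 0) := by
  have : IsProbabilityMeasure (P.map (X 0)) :=
    Measure.isProbabilityMeasure_map (hX 0).aemeasurable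
  choose 𝓑 hfin h𝓑 hcover using fun m : ℕ => hvc.exists_finite_brackets (P.map (X 0)) hsep hmeas
    (Nat.one_div_pos_of_nat (α := ℝ) (n := m))
  have hae : ∀ᵐ ω ∂P, ∀ m, ∀ p ∈ 𝓑 m,
      Tendsto (fun n : ℕ => (n : ℝ)⁻¹ * ∑ i ∈ Finset.range n,
        p.1.indicator (fun _ => (1 : ℝ)) (X i ω)) atTop (𝓝 ((P.map (X 0)).real p.1)) ∧
      Tendsto (fun n : ℕ => (n : ℝ)⁻¹ * ∑ i ∈ Finset.range n,
        p.2.indicator (fun _ => (1 : ℝ)) (X i ω)) atTop (𝓝 ((P.map (X 0)).real p.2)) :=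
    ae_all_iff.2 fun m => (ae_ball_iff (hfin m).countable).2 fun p hp =>
      (ae_tendsto_frequency hX hstat herg (h𝓑 m p hp).1).and
        (ae_tendsto_frequency hX hstat herg (h𝓑 m p hp).2.1)
  filter_upwards [hae] with ω hω
  refine Metric.tendsto_nhds.2 fun ε hε => ?_
  obtain ⟨m, hm⟩ := exists_nat_one_div_lt (show 0 < ε / 3 by positivity)
  have hev := (Filter.eventually_all_finite (hfin m)).2 fun p hp =>
    (Metric.tendsto_nhds.1 (hω m p hp).1 (ε / 3) (by positivity)).and
      (Metric.tendsto_nhds.1 (hω m p hp).2 (ε / 3) (by positivity))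
  filter_upwards [hev] with n hn
  have hle : discrepancy P X 𝒞 n ω ≤ 2 * (ε / 3) := by
    refine Real.iSup_le (fun C => ?_) (by positivity)
    obtain ⟨p, hp, hpC, hCp⟩ := hcover m C C.2
    have hmono {A B : Set S} (hAB : A ⊆ B) :
        (n : ℝ)⁻¹ * ∑ i ∈ Finset.range n, A.indicator (fun _ => (1 : ℝ)) (X i ω) ≤
          (n : ℝ)⁻¹ * ∑ i ∈ Finset.range n, B.indicator (fun _ => (1 : ℝ)) (X i ω) := by
      gcongr
    have hC : P.real {ω' | X 0 ω' ∈ (C : Set S)} = (P.map (X 0)).real C :=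
      (map_measureReal_apply (hX 0) (hmeas C C.2)).symm
    have h₁ := measureReal_mono (μ := P.map (X 0)) hpC
    have h₂ := measureReal_mono (μ := P.map (X 0)) hCp
    have h₃ : (P.map (X 0)).real p.2 ≤ (P.map (X 0)).real p.1 + (P.map (X 0)).real (p.2 \ p.1) :=
      (measureReal_mono (by rw [Set.union_sdiff_self]; exact Set.subset_union_right)).trans
        (measureReal_union_le _ _)
    have h₄ := (h𝓑 m p hp).2.2
    obtain ⟨hn₁, hn₂⟩ := hn p hp
    rw [Real.dist_eq, abs_lt] at hn₁ hn₂
    rw [hC, abs_le]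
    constructor <;> linarith [hmono hpC, hmono hCp, hn₁.1, hn₂.2]
  have hnonneg : 0 ≤ discrepancy P X 𝒞 n ω := Real.iSup_nonneg fun C => abs_nonneg _
  rw [Real.dist_eq, sub_zero, abs_of_nonneg hnonneg]
  linarith
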